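/- Let $B$ be the open unit ball of $\mathbb{C}^2$ and $S=\partial B$. Let $f=(f_1,f_2):\mathbb{C}^2\to\mathbb{C}^2$ be holomorphic and let $M\subset\mathbb{C}^2$ be a bounded open set with smooth boundary such that $f(M)=B$, $f(\partial M)=S$, and $f:\overline M\to\overline B$ is a finite ramified covering with $N$ sheets (all fibres are finite, and there is a closed set $A$, contained near each point of $\overline B$ in the zero set of a holomorphic function that is not identically zero, such that near each point of $\overline B\setminus A$ the fibre of $f$ in $\overline M$ consists of the values of $N$ local sections with pairwise distinct values, continuous on $\overline B$ and holomorphic in $B$ near that point). Let $E$ be a set of nonnegative integers that contains arbitrarily long intervals of consecutive integers. An $(E,f)$-polynomial is a finite sum $\sum_{k\in E}p_k(f_1,f_2)$ in which each $p_k$ is a homogeneous polynomial of degree $k$ in two variables with complex coefficients. Let $\mu$ be a nonzero positive Borel measure on $\partial M$. If $\varphi:\overline B\to(0,\infty)$ is lower semicontinuous and $\varphi\circ f\in L^2(\mu)$, then there is an $(E,f)$-polynomial $P$ such that $|P(z)|<\varphi(f(z))$ for every $z\in\overline M$ and $$\int_{\partial M}|P|^2\,d\mu>\frac{8}{25}\int_{\partial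 M}(\varphi\circ f)^2\,d\mu .$$ -/

import Mathlib

open Set MeasureTheory Metric
open scoped ContDiff

/-- `ℂ²` with its Euclidean (Hermitian) norm. -/
abbrev C2 : Type := EuclideanSpace ℂ (Fin 2)

/-- The open set `M` has smooth boundary: near every boundary point it is a strict sublevel set
of a smooth real function with nonvanishing differential at that point. -/
def HasSmoothBoundary (M : Set C2) : Prop :=
  ∀ p ∈ frontier M, ∃ (U : Set C2) (ρ : C2 → ℝ), IsOpen U ∧ p ∈ U ∧ ContDiffOn ℝ ∞ ρ U ∧
    fderiv ℝ ρ p ≠ 0 ∧ M ∩ U = {z | z ∈ U ∧ ρ z < 0}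

/-- `A` is thin along the closed unit ball: near each point of the closed ball it lies in the zero
set of a holomorphic function that does not vanish identically. -/
def IsThinInClosedBall (A : Set C2) : Prop :=
  ∀ a ∈ closedBall (0 : C2) 1, ∃ (U : Set C2) (h : C2 → ℂ), IsOpen U ∧ IsConnected U ∧ a ∈ U ∧
    DifferentiableOn ℂ h U ∧ (∃ w ∈ U, h w ≠ 0) ∧ ∀ w ∈ A ∩ U, h w = 0

/-- `f : closure M → closedBall 0 1` is a finite ramified covering with `N` sheets: all fibres are
finite, and off a closed thin set the fibre over a point consists of the values of `N` local
sections of `f` with pairwise distinct values; the sections are continuous up to the sphere and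
holomorphic inside the ball. -/
structure IsFiniteRamifiedCovering (M : Set C2) (f : C2 → C2) (N : ℕ) : Prop where
  finite_fibre : ∀ w ∈ closedBall (0 : C2) 1, (closure M ∩ f ⁻¹' {w}).Finite
  sheets : ∃ A : Set C2, IsClosed A ∧ IsThinInClosedBall A ∧
    ∀ w ∈ closedBall (0 : C2) 1 \ A, ∃ (U : Set C2) (g : Fin N → C2 → C2), IsOpen U ∧ w ∈ U ∧
      (∀ i, ContinuousOn (g i) (U ∩ closedBall 0 1)) ∧
      (∀ i, DifferentiableOn ℂ (g i) (U ∩ ball 0 1)) ∧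
      ∀ v ∈ U ∩ closedBall (0 : C2) 1,
        Function.Injective (fun i => g i v) ∧ closure M ∩ f ⁻¹' {v} = range (fun i => g i v)

/-- The geometric setting: `f : ℂ² → ℂ²` is holomorphic, `M` is a bounded open subset of `ℂ²` with
smooth boundary, `f` maps `M` onto the open unit ball and `∂M` onto the unit sphere, and
`f : closure M → closedBall 0 1` is a finite ramified covering with `N` sheets. -/
structure IsBallCovering (M : Set C2) (f : C2 → C2) (N : ℕ) : Prop where
  holomorphic : Differentiable ℂ f
  isOpen : IsOpen M
  isBounded : Bornology.IsBounded M
  smooth_boundary : HasSmoothBoundary M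
  image_interior : f '' M = ball 0 1
  image_boundary : f '' frontier M = sphere 0 1
  ramified : IsFiniteRamifiedCovering M f N

/-- `F` is a homogeneous `f`-polynomial of degree `k`: a homogeneous polynomial of degree `k` in
the two components of `f`. -/
def IsHomogeneousFPolynomial (f : C2 → C2) (k : ℕ) (F : C2 → ℂ) : Prop :=
  ∃ p : MvPolynomial (Fin 2) ℂ, p.IsHomogeneous k ∧
    ∀ z, F z = MvPolynomial.eval (fun i => f z i) p

/-- `P` is an `(E,f)`-polynomial: a finite sum of homogeneous `f`-polynomials `F k` of degree `k`,
with `k` in `E`. -/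
def IsEFPolynomial (E : Set ℕ) (f : C2 → C2) (P : C2 → ℂ) : Prop :=
  ∃ (s : Finset ℕ) (F : ℕ → C2 → ℂ), (s : Set ℕ) ⊆ E ∧
    (∀ k ∈ s, IsHomogeneousFPolynomial f k (F k)) ∧ ∀ z, P z = ∑ k ∈ s, F k z

/-- `E` is an LI-set: it contains arbitrarily long intervals of consecutive integers. -/
def IsLISet (E : Set ℕ) : Prop :=
  ∀ m : ℕ, 1 ≤ m → ∃ a : ℕ, ∀ j : ℕ, 1 ≤ j → j ≤ m → j + a ∈ E

/-!
The composition of `f` with a polynomial on `ℂ²` with degrees in `E` is an `(E, f)`-polynomial, and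
`f` maps the closure of `M` to the closed ball and `∂M` to the sphere. So the theorem concerns
polynomials `p` on the closed ball and a map `w` (the restriction of `f` to `∂M`) from a measure
space to the sphere: `p` must satisfy `|p| < φ` on the ball, and `|p ∘ w|` must be large in mean
square.

It is enough to reach a fraction `c` of the mean square of `φ`, for some `c > 0` independent of `φ`.
Given an admissible `p`, the gap `φ - |p|` is again positive and lower semicontinuous; if `q` fits
into the gap, both `p + q` and `p - q` are admissible, and by the parallelogram law one of them has
mean square at least the sum of those of `p` and `q`. As long as the mean square of `p` is at most
`θ < 1 / 2` times that of `φ`, the gap has a mean square bounded below, so each step gains a fixed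
amount, which cannot go on forever (`exists_polynomial_lt_of_mean_square`; the theorem is the case
`θ = 8 / 25`).

For some fraction `c` (`exists_polynomial_lt_lipschitz`), lower semicontinuity lets `φ` be replaced
by a Lipschitz function `ψ ≤ φ`, an infimal convolution. By the Stone–Weierstrass theorem `ψ` is
close on the sphere to a finite sum of continuous functions `g t` with
`g t (λ ζ) = λ ^ (d t) * g t ζ` for `|λ| = 1`. Choose a maximal family of points `ζ` on the sphere
whose complex lines are at mutual distance at least about `N ^ (-1 / 2)`, and let `v ζ` be the
function `z ↦ ∑ t, g t ζ * ⟨ζ, z⟩ ^ (N + e t)`, where `e t` is `d t` plus a constant. The degrees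
stay in a window of fixed length, which can be placed in `E` with `N` arbitrarily large because `E`
contains long intervals. Near the circle through `ζ` the modulus of `v ζ` is about
`|⟨ζ, z⟩| ^ N * ψ z`, and elsewhere `v ζ` is negligible. The sum of `|⟨ζ, z⟩| ^ N` over the family is
bounded by an absolute constant, by a packing argument (`exists_peak_sum_bound`), so every signed
sum of the `v ζ` is at most a constant multiple of `ψ`. For suitable signs its mean square is at
least the sum of those of the `v ζ` (`exists_signs_sum_integral_le`), which is comparable with that
of `ψ` because, by maximality, every point of the sphere is close to one of the lines.
-/

/-! ### Sums of peak functions on the ball -/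

theorem exp_neg_half_sq_le {t : ℝ} (ht : 0 ≤ t) :
    Real.exp (-(t ^ 2 / 2)) ≤ 1728 * (1 + t) ^ (-6 : ℝ) := by
  have h1 : (1 + t) ^ 2 ≤ 12 * Real.exp (t ^ 2 / 6) := by
    nlinarith [Real.add_one_le_exp (t ^ 2 / 6), sq_nonneg (t - 1)]
  have h2 : (1 + t) ^ 6 ≤ 1728 * Real.exp (t ^ 2 / 2) := by
    calc (1 + t) ^ 6 = ((1 + t) ^ 2) ^ 3 := by ring
      _ ≤ (12 * Real.exp (t ^ 2 / 6)) ^ 3 := pow_le_pow_left₀ (by positivity) h1 3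
      _ = 1728 * Real.exp (t ^ 2 / 2) := by
        rw [mul_pow, ← Real.exp_nat_mul]; norm_num; ring_nf
  have h3 : (1 + t) ^ (-6 : ℝ) = ((1 + t) ^ 6)⁻¹ := by
    rw [Real.rpow_neg (by positivity)]; norm_cast
  rw [h3, Real.exp_neg, ← div_eq_mul_inv, inv_le_comm₀ (Real.exp_pos _) (by positivity), inv_div,
    div_le_iff₀ (by norm_num)]
  linarith

/-- Gaussian sums over separated families are bounded independently of the family. The balls of
radius `r / 2` about the points are disjoint, so the sum is dominated by the integral of the
integrable function `(1 + ‖x‖) ^ (-6)` on the real four-dimensional space `ℂ²`. -/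
theorem exists_gaussian_sum_bound {r : ℝ} (hr : 0 < r) (hr2 : r ≤ 2) :
    ∃ C : ℝ, 0 < C ∧ ∀ (Λ : Finset C2) (y : C2 → C2),
      (∀ a ∈ Λ, ∀ b ∈ Λ, a ≠ b → r ≤ dist (y a) (y b)) →
      ∑ a ∈ Λ, Real.exp (-(‖y a‖ ^ 2 / 2)) ≤ C := by
  let ν : Measure C2 := Measure.addHaar
  let F : C2 → ℝ := fun x => (1 + ‖x‖) ^ (-6 : ℝ)
  have hF : Integrable F ν := by
    apply integrable_one_add_norm
    have : Module.finrank ℝ C2 = 4 := by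
      rw [← Module.finrank_mul_finrank ℝ ℂ C2]; simp
    rw [this]; norm_num
  have hF0 : ∀ x, 0 ≤ F x := fun x => by positivity
  let V : ℝ := ν.real (ball 0 (r / 2))
  have hV : 0 < V := by
    refine ENNReal.toReal_pos (measure_ball_pos _ _ (by positivity)).ne' measure_ball_lt_top.ne
  have hI : 0 ≤ ∫ x, F x ∂ν := integral_nonneg hF0
  refine ⟨1728 * 64 * V⁻¹ * (∫ x, F x ∂ν) + 1, by positivity, fun Λ y hy => ?_⟩
  have hball : ∀ a ∈ Λ, Real.exp (-(‖y a‖ ^ 2 / 2)) ≤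
      1728 * 64 * V⁻¹ * ∫ x in ball (y a) (r / 2), F x ∂ν := by
    intro a _
    have h1 := exp_neg_half_sq_le (norm_nonneg (y a))
    have h2 : ∀ x ∈ ball (y a) (r / 2), (1 + ‖y a‖) ^ (-6 : ℝ) / 64 ≤ F x := by
      intro x hx
      rw [mem_ball, dist_eq_norm] at hx
      have : ‖x‖ ≤ ‖y a‖ + 1 := by
        have := norm_le_insert' x (y a)
        linarith
      have h3 : 1 + ‖x‖ ≤ 2 * (1 + ‖y a‖) := by linarith [norm_nonneg (y a)]
      calc (1 + ‖y a‖) ^ (-6 : ℝ) / 64 = (2 * (1 + ‖y a‖)) ^ (-6 : ℝ) := by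
            have h5 : (2 : ℝ) ^ (-6 : ℝ) = 1 / 64 := by
              rw [Real.rpow_neg (by norm_num)]; norm_num
            rw [Real.mul_rpow (by norm_num) (by positivity), h5]; ring
        _ ≤ F x := Real.rpow_le_rpow_of_nonpos (by positivity) h3 (by norm_num)
    have h4 : (1 + ‖y a‖) ^ (-6 : ℝ) / 64 * V ≤ ∫ x in ball (y a) (r / 2), F x ∂ν := by
      have : V = ν.real (ball (y a) (r / 2)) := by
        simp only [V, Measure.real, Measure.addHaar_ball_center]
      rw [this, mul_comm, ← smul_eq_mul, ← setIntegral_const]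
      refine setIntegral_mono_on (integrableOn_const measure_ball_lt_top.ne) hF.integrableOn
        measurableSet_ball h2
    calc _ ≤ 1728 * (1 + ‖y a‖) ^ (-6 : ℝ) := h1
      _ = 1728 * 64 * V⁻¹ * ((1 + ‖y a‖) ^ (-6 : ℝ) / 64 * V) := by field_simp
      _ ≤ _ := by gcongr
  have hdisj : (Λ : Set C2).Pairwise
      (Function.onFun Disjoint fun a => ball (y a) (r / 2)) := by
    intro a ha b hb hab
    exact ball_disjoint_ball (by linarith [hy a ha b hb hab])
  calc _ ≤ ∑ a ∈ Λ, 1728 * 64 * V⁻¹ * ∫ x in ball (y a) (r / 2), F x ∂ν := Finset.sum_le_sum hball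
    _ = 1728 * 64 * V⁻¹ * ∫ x in ⋃ a ∈ Λ, ball (y a) (r / 2), F x ∂ν := by
      rw [← Finset.mul_sum, integral_biUnion_finset Λ (fun _ _ => measurableSet_ball) hdisj
        (fun _ _ => hF.integrableOn)]
    _ ≤ 1728 * 64 * V⁻¹ * (∫ x, F x ∂ν) := by
      exact mul_le_mul_of_nonneg_left
        (setIntegral_le_integral hF (Filter.Eventually.of_forall hF0)) (by positivity)
    _ ≤ _ := by linarith

theorem exists_rotation_inner_eq_norm (ζ z : C2) :
    ∃ c : ℂ, ‖c‖ = 1 ∧ inner ℂ (c • ζ) z = (‖inner ℂ ζ z‖ : ℂ) := by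
  obtain ⟨c, hc, h⟩ := RCLike.exists_norm_eq_mul_self (inner ℂ ζ z)
  refine ⟨(starRingEnd ℂ) c, by simpa using hc, ?_⟩
  rw [inner_smul_left, Complex.conj_conj]
  exact h.symm

theorem norm_sub_sq_of_norm_one {ζ z : C2} (hζ : ‖ζ‖ = 1) :
    ‖ζ - z‖ ^ 2 = 1 + ‖z‖ ^ 2 - 2 * (inner ℂ ζ z).re := by
  have := norm_sub_sq (𝕜 := ℂ) ζ z
  rw [this, hζ]; simp only [RCLike.re_to_complex]; ring

/-- The peak functions `z ↦ |⟨ζ, z⟩| ^ N` at the points of a family on the sphere whose complex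
lines are at mutual distance of order at least `N ^ (-1 / 2)` have a bounded sum on the closed ball.
After a rotation of each `ζ` in its line the peaks are Gaussians centred at separated points. -/
theorem exists_peak_sum_bound : ∃ C : ℝ, 0 < C ∧ ∀ (N : ℕ) (Λ : Finset C2),
    (∀ a ∈ Λ, ‖a‖ = 1) →
    (∀ a ∈ Λ, ∀ b ∈ Λ, a ≠ b → 1 ≤ 2 * N * (2 - 2 * ‖inner ℂ a b‖)) →
    ∀ z : C2, ‖z‖ ≤ 1 → ∑ a ∈ Λ, ‖inner ℂ a z‖ ^ N ≤ C := by
  obtain ⟨C, hC, h⟩ := exists_gaussian_sum_bound (r := 1 / 2) (by norm_num) (by norm_num)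
  refine ⟨C, hC, fun N Λ hΛ hsep z hz => ?_⟩
  choose c hc hcz using fun a => exists_rotation_inner_eq_norm a z
  have hcn : ∀ a ∈ Λ, ‖c a • a‖ = 1 := fun a ha => by rw [norm_smul, hc, hΛ a ha, one_mul]
  refine le_trans (Finset.sum_le_sum ?_) (h Λ (fun a => (√N : ℂ) • (c a • a - z)) ?_)
  · intro a ha
    have h1 := norm_sub_sq_of_norm_one (z := z) (hcn a ha)
    rw [hcz, Complex.ofReal_re] at h1
    have h2 : ‖inner ℂ a z‖ ≤ Real.exp (-(‖c a • a - z‖ ^ 2 / 2)) := by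
      have := Real.add_one_le_exp (-(‖c a • a - z‖ ^ 2 / 2))
      nlinarith [norm_nonneg z]
    calc ‖inner ℂ a z‖ ^ N ≤ Real.exp (-(‖c a • a - z‖ ^ 2 / 2)) ^ N :=
          pow_le_pow_left₀ (norm_nonneg _) h2 N
      _ = _ := by
        rw [← Real.exp_nat_mul, norm_smul, mul_pow, Complex.norm_real, Real.norm_eq_abs, sq_abs,
          Real.sq_sqrt (Nat.cast_nonneg N)]
        ring_nf
  · intro a ha b hb hab
    rw [dist_eq_norm, ← smul_sub, sub_sub_sub_cancel_right]
    have h1 := norm_sub_sq_of_norm_one (z := c b • b) (hcn a ha)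
    have h2 : (inner ℂ (c a • a) (c b • b)).re ≤ ‖inner ℂ a b‖ := by
      refine (Complex.re_le_norm _).trans ?_
      rw [inner_smul_left, inner_smul_right, norm_mul, norm_mul, hc, RCLike.norm_conj, hc]
      simp
    have h3 := hsep a ha b hb hab
    rw [hcn b hb] at h1
    have h4 : (1 / 2 : ℝ) ^ 2 ≤ ‖(√N : ℂ) • (c a • a - c b • b)‖ ^ 2 := by
      rw [norm_smul, mul_pow, Complex.norm_real, Real.norm_eq_abs, sq_abs,
          Real.sq_sqrt (Nat.cast_nonneg N), h1]
      have : (0 : ℝ) ≤ N := Nat.cast_nonneg N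
      nlinarith
    exact le_of_sq_le_sq h4 (norm_nonneg _)

/-- A maximal family of points on the sphere whose complex lines are separated; by maximality these
lines come close to every point of the sphere. -/
theorem exists_maximal_separated {s : ℝ} (hs : 0 < s) : ∃ Λ : Finset C2,
    (∀ a ∈ Λ, ‖a‖ = 1) ∧ (∀ a ∈ Λ, ∀ b ∈ Λ, a ≠ b → s ≤ 2 - 2 * ‖inner ℂ a b‖) ∧
    ∀ z : C2, ‖z‖ = 1 → ∃ a ∈ Λ, 2 - 2 * ‖inner ℂ a z‖ < s := by
  let R : C2 → C2 → Prop := fun a b => s ≤ 2 - 2 * ‖inner ℂ a b‖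
  obtain ⟨Λ, hΛ⟩ := zorn_subset {Λ : Set C2 | Λ ⊆ sphere 0 1 ∧ Λ.Pairwise R} (by
    intro c hc hchain
    refine ⟨⋃₀ c, ⟨sUnion_subset fun t ht => (hc ht).1, ?_⟩, fun t ht => subset_sUnion_of_mem ht⟩
    exact (pairwise_sUnion hchain.directedOn).2 fun t ht => (hc ht).2)
  have hnorm : ∀ a ∈ Λ, ‖a‖ = 1 := fun a ha => by simpa using hΛ.prop.1 ha
  have hfin : Λ.Finite := by
    obtain ⟨t, -, htf, ht⟩ := (isCompact_sphere (0 : C2) 1).finite_cover_balls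
      (show 0 < √s / 2 by positivity)
    have : ∀ a ∈ Λ, ∃ x ∈ t, a ∈ ball x (√s / 2) := fun a ha => by
      simpa using ht (hΛ.prop.1 ha)
    choose! x hxt hx using this
    refine htf.of_injOn (f := x) hxt fun a ha b hb hab => ?_
    by_contra hne
    have h1 : dist a b < √s := by
      have h2 := hx a ha
      have h3 := hx b hb
      rw [mem_ball] at h2 h3
      rw [← hab] at h3
      linarith [dist_triangle_right a b (x a)]
    have h2 : s ≤ ‖a - b‖ ^ 2 := by
      rw [norm_sub_sq_of_norm_one (hnorm a ha), hnorm b hb]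
      have := hΛ.prop.2 ha hb hne
      linarith [Complex.re_le_norm (inner ℂ a b)]
    rw [dist_eq_norm] at h1
    nlinarith [Real.sq_sqrt hs.le, norm_nonneg (a - b), Real.sqrt_nonneg s]
  refine ⟨hfin.toFinset, by simpa using hnorm, fun a ha b hb => ?_, fun z hz => ?_⟩
  · exact hΛ.prop.2 (by simpa using ha) (by simpa using hb)
  · by_contra! hcon
    have hcon' : ∀ a ∈ Λ, s ≤ 2 - 2 * ‖inner ℂ a z‖ := by simpa using hcon
    have hz' : z ∈ Λ := by
      refine hΛ.le_of_ge (y := insert z Λ) ⟨?_, ?_⟩ (subset_insert z Λ) (mem_insert z Λ)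
      · exact insert_subset (by simpa using hz) hΛ.prop.1
      · refine hΛ.prop.2.insert fun b hb _ => ⟨?_, hcon' b hb⟩
        simp only [R]
        rw [norm_inner_symm]
        exact hcon' b hb
    have := hcon' z hz'
    rw [inner_self_eq_norm_sq_to_K, hz] at this
    norm_num at this
    linarith

/-! ### Functions homogeneous under the circle action -/

/-- A continuous function `g` on the sphere is homogeneous of degree `d : ℤ` under the circle
action: `g (λ ζ) = λ ^ d * g ζ` whenever `|λ| = 1`. -/
def IsCircleHomogeneous (d : ℤ) (g : C(sphere (0 : C2) 1, ℂ)) : Prop :=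
  ∀ (x y : sphere (0 : C2) 1) (c : ℂ), ‖c‖ = 1 → (y : C2) = c • (x : C2) → g y = c ^ d * g x

/-- The multiplicative monoid of the functions on the sphere that are homogeneous of some integer
degree under the circle action. -/
def circleHomogeneousMonoid : Submonoid C(sphere (0 : C2) 1, ℂ) where
  carrier := {g | ∃ d, IsCircleHomogeneous d g}
  one_mem' := ⟨0, fun x y c _ _ => by simp⟩
  mul_mem' := by
    rintro a b ⟨d, hd⟩ ⟨e, he⟩
    refine ⟨d + e, fun x y c hc h => ?_⟩
    have : c ≠ 0 := by rintro rfl; simp at hc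
    rw [ContinuousMap.mul_apply, ContinuousMap.mul_apply, hd x y c hc h, he x y c hc h,
      zpow_add₀ this]
    ring

theorem IsCircleHomogeneous.smul {d : ℤ} {g : C(sphere (0 : C2) 1, ℂ)}
    (hg : IsCircleHomogeneous d g) (a : ℂ) : IsCircleHomogeneous d (a • g) := by
  intro x y c hc h
  rw [ContinuousMap.smul_apply, ContinuousMap.smul_apply, hg x y c hc h, smul_eq_mul, smul_eq_mul]
  ring

theorem IsCircleHomogeneous.star {d : ℤ} {g : C(sphere (0 : C2) 1, ℂ)}
    (hg : IsCircleHomogeneous d g) : IsCircleHomogeneous (-d) (star g) := by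
  intro x y c hc h
  rw [ContinuousMap.star_apply, ContinuousMap.star_apply, hg x y c hc h, star_mul', star_zpow₀,
    zpow_neg, ← inv_zpow, Complex.inv_eq_conj hc]
  rfl

/-- The star algebra spanned by the circle-homogeneous functions on the sphere. -/
noncomputable def circleHomogeneousSubalgebra : StarSubalgebra ℂ C(sphere (0 : C2) 1, ℂ) where
  toSubalgebra := Algebra.adjoin ℂ circleHomogeneousMonoid
  star_mem' := by
    intro a ha
    refine Algebra.adjoin_induction (p := fun a _ => star a ∈ Algebra.adjoin ℂ _) ?_ ?_ ?_ ?_ ha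
    · rintro x ⟨d, hd⟩
      exact Algebra.subset_adjoin ⟨-d, hd.star⟩
    · intro r
      rw [← algebraMap_star_comm]
      exact Subalgebra.algebraMap_mem _ _
    · intro x y _ _ hx hy
      rw [star_add]; exact add_mem hx hy
    · intro x y _ _ hx hy
      rw [star_mul]; exact mul_mem hy hx

theorem circleHomogeneousSubalgebra_dense :
    circleHomogeneousSubalgebra.topologicalClosure = ⊤ := by
  apply ContinuousMap.starSubalgebra_topologicalClosure_eq_top_of_separatesPoints
  intro x y hxy
  have : ∃ i, (x : C2) i ≠ (y : C2) i := by
    by_contra! h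
    exact hxy (Subtype.ext (by ext i; exact h i))
  obtain ⟨i, hi⟩ := this
  refine ⟨_, ⟨⟨fun z => (z : C2) i, by fun_prop⟩, ?_, rfl⟩, hi⟩
  refine Algebra.subset_adjoin ⟨1, fun a b c _ h => ?_⟩
  simp [h]

/-- By the Stone–Weierstrass theorem, continuous functions on the sphere are uniform limits of sums
of circle-homogeneous ones. -/
theorem exists_circleHomogeneous_approx (ψ : C(sphere (0 : C2) 1, ℂ)) {ε : ℝ} (hε : 0 < ε) :
    ∃ (n : ℕ) (g : Fin n → C(sphere (0 : C2) 1, ℂ)) (d : Fin n → ℤ),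
      (∀ t, IsCircleHomogeneous (d t) (g t)) ∧ ∀ x, ‖∑ t, g t x - ψ x‖ < ε := by
  have hψ : ψ ∈ circleHomogeneousSubalgebra.topologicalClosure := by
    rw [circleHomogeneousSubalgebra_dense]; trivial
  obtain ⟨h, hh, hdist⟩ := Metric.mem_closure_iff.1 hψ ε hε
  have hspan : h ∈ Submodule.span ℂ (circleHomogeneousMonoid : Set C(sphere (0 : C2) 1, ℂ)) := by
    have : h ∈ Subalgebra.toSubmodule (Algebra.adjoin ℂ
      (circleHomogeneousMonoid : Set C(sphere (0 : C2) 1, ℂ))) := hh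
    rwa [Algebra.adjoin_eq_span, Submonoid.closure_eq] at this
  obtain ⟨n, a, g, rfl⟩ := Submodule.mem_span_set'.1 hspan
  choose d hd using fun t => (g t).2
  refine ⟨n, fun t => a t • (g t : C(sphere (0 : C2) 1, ℂ)), d, fun t => (hd t).smul _, fun x => ?_⟩
  rw [← dist_eq_norm, dist_comm]
  refine lt_of_le_of_lt ?_ hdist
  simpa using ContinuousMap.dist_apply_le_dist (f := ψ) (g := ∑ t, a t • (g t).1) x

/-- Near the circle through a point `ζ` of the sphere, a Lipschitz function `ψ` has, up to a small
error, the modulus of a polynomial in `⟨ζ, z⟩` whose degree does not depend on `ζ`. -/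
theorem exists_polynomial_model {K : NNReal} {ψ : C2 → ℝ} (hψ : LipschitzWith K ψ) {ε : ℝ}
    (hε : 0 < ε) :
    ∃ (n m : ℕ) (g : Fin n → C2 → ℂ) (e : Fin n → ℕ) (H δ : ℝ), 0 < δ ∧ δ < 1 ∧ 0 ≤ H ∧
      (∀ t, e t ≤ m) ∧ (∀ ζ, ‖ζ‖ = 1 → (∑ t, ‖g t ζ‖) ≤ H) ∧
      ∀ ζ z : C2, ‖ζ‖ = 1 → ‖z‖ ≤ 1 → 1 - δ ≤ ‖inner ℂ ζ z‖ →
        |(‖∑ t, g t ζ * inner ℂ ζ z ^ e t‖ - |ψ z|)| ≤ ε := by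
  classical
  obtain ⟨n, G, d, hG, happ⟩ := exists_circleHomogeneous_approx
    ⟨fun x => (ψ x : ℂ), by have := hψ.continuous; fun_prop⟩ (show 0 < ε / 3 by positivity)
  let g : Fin n → C2 → ℂ := fun t ζ => if h : ζ ∈ sphere (0 : C2) 1 then G t ⟨ζ, h⟩ else 0
  have hg : ∀ t (x : sphere (0 : C2) 1), g t x = G t x := fun t x => by simp [g]
  let m : ℕ := ∑ t, (d t).natAbs
  have hdm : ∀ t, (d t).natAbs ≤ m := fun t =>
    Finset.single_le_sum (f := fun t => (d t).natAbs) (fun _ _ => Nat.zero_le _) (Finset.mem_univ t)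
  let e : Fin n → ℕ := fun t => (d t + m).toNat
  have he : ∀ t, (e t : ℤ) = d t + m := fun t => by
    have := hdm t
    simp only [e]; omega
  have he2 : ∀ t, e t ≤ 2 * m := fun t => by
    have := hdm t
    have := he t
    omega
  let H : ℝ := ∑ t, ‖G t‖
  have hH : 0 ≤ H := Finset.sum_nonneg fun t _ => norm_nonneg _
  have hgH : ∀ ζ : C2, ‖ζ‖ = 1 → (∑ t, ‖g t ζ‖) ≤ H := fun ζ hζ =>
    Finset.sum_le_sum fun t _ => by
      rw [hg t ⟨ζ, by simpa using hζ⟩]; exact (G t).norm_coe_le_norm _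
  let δ : ℝ := min (1 / 2) (min (ε / (3 * (H * (2 * m) + 1))) ((ε / (3 * (K + 1))) ^ 2 / 2))
  have hδ : 0 < δ := by
    refine lt_min (by norm_num) (lt_min ?_ ?_) <;> positivity
  have hδ1 : δ ≤ 1 / 2 := min_le_left _ _
  have hδ2 : δ ≤ ε / (3 * (H * (2 * m) + 1)) := (min_le_right _ _).trans (min_le_left _ _)
  have hδ3 : δ ≤ (ε / (3 * (K + 1))) ^ 2 / 2 := (min_le_right _ _).trans (min_le_right _ _)
  refine ⟨n, 2 * m, g, e, H, δ, hδ, by linarith, hH, he2, hgH, fun ζ z hζ hz hu => ?_⟩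
  set u := inner ℂ ζ z with hudef
  set ρ := ‖u‖ with hρ
  have hρ0 : 0 < ρ := by linarith
  have hρ1 : ρ ≤ 1 := by
    have := norm_inner_le_norm (𝕜 := ℂ) ζ z
    rw [hζ, one_mul] at this
    exact this.trans hz
  have hρc : (ρ : ℂ) ≠ 0 := by exact_mod_cast hρ0.ne'
  -- the polar decomposition `u = ρ c` and the point `y = c ζ` of the circle of `ζ` nearest to `z`
  set c : ℂ := u / ρ with hc
  have hcn : ‖c‖ = 1 := by
    rw [hc, norm_div, Complex.norm_real, Real.norm_eq_abs, abs_of_pos hρ0]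
    exact div_self hρ0.ne'
  have hc0 : c ≠ 0 := by intro h; rw [h] at hcn; simp at hcn
  have huc : u = ρ * c := by rw [hc]; field_simp
  have hyn : ‖c • ζ‖ = 1 := by rw [norm_smul, hcn, hζ, one_mul]
  have hyz : inner ℂ (c • ζ) z = (ρ : ℂ) := by
    rw [inner_smul_left, ← hudef, huc]
    have : (starRingEnd ℂ) c * c = 1 := by
      rw [mul_comm, Complex.mul_conj, Complex.normSq_eq_norm_sq, hcn]; simp
    linear_combination (ρ : ℂ) * this
  have h1 : |‖∑ t, g t ζ * u ^ e t‖ - ‖∑ t, g t ζ * c ^ e t‖| ≤ ε / 3 := by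
    refine (abs_norm_sub_norm_le _ _).trans ?_
    rw [← Finset.sum_sub_distrib]
    have hbern : 1 - 2 * m * δ ≤ ρ ^ (2 * m) := by
      have h2 := one_add_mul_le_pow (a := ρ - 1) (by linarith) (2 * m)
      push_cast at h2
      rw [add_sub_cancel] at h2
      have : (0 : ℝ) ≤ m := Nat.cast_nonneg m
      nlinarith
    have hterm : ∀ t, ‖g t ζ * u ^ e t - g t ζ * c ^ e t‖ ≤ ‖g t ζ‖ * (2 * m * δ) := by
      intro t
      have : g t ζ * u ^ e t - g t ζ * c ^ e t = g t ζ * (c ^ e t * ((ρ ^ e t - 1 : ℝ) : ℂ)) := by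
        rw [huc, mul_pow]; push_cast; ring
      rw [this, norm_mul, norm_mul, norm_pow, hcn, one_pow, one_mul, Complex.norm_real,
        Real.norm_eq_abs]
      have h3 : ρ ^ e t ≤ 1 := pow_le_one₀ hρ0.le hρ1
      have h4 : ρ ^ (2 * m) ≤ ρ ^ e t := pow_le_pow_of_le_one hρ0.le hρ1 (he2 t)
      gcongr
      rw [abs_le]; constructor <;> linarith
    calc _ ≤ ∑ t, ‖g t ζ‖ * (2 * m * δ) := norm_sum_le_of_le _ fun t _ => hterm t
      _ = (∑ t, ‖g t ζ‖) * (2 * m * δ) := by rw [Finset.sum_mul]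
      _ ≤ H * (2 * m * δ) := by gcongr; exact hgH ζ hζ
      _ ≤ ε / 3 := by
        rw [le_div_iff₀ (by positivity)] at hδ2
        nlinarith
  have h2 : ‖∑ t, g t ζ * c ^ e t‖ = ‖∑ t, g t (c • ζ)‖ := by
    have : ∑ t, g t ζ * c ^ e t = c ^ m * ∑ t, g t (c • ζ) := by
      rw [Finset.mul_sum]
      refine Finset.sum_congr rfl fun t _ => ?_
      have h3 := hG t ⟨ζ, by simpa using hζ⟩ ⟨c • ζ, by simpa using hyn⟩ c hcn rfl
      rw [← hg, ← hg] at h3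
      simp only at h3
      rw [h3, ← zpow_natCast, ← zpow_natCast, he, zpow_add₀ hc0]; ring
    rw [this, norm_mul, norm_pow, hcn, one_pow, one_mul]
  have h3 : |(‖∑ t, g t (c • ζ)‖ - |ψ (c • ζ)|)| ≤ ε / 3 := by
    have h4 := (happ ⟨c • ζ, by simpa using hyn⟩).le
    simp only [← hg, ContinuousMap.coe_mk] at h4
    have h5 := (abs_norm_sub_norm_le _ _).trans h4
    rwa [Complex.norm_real, Real.norm_eq_abs] at h5
  have h4 : |(|ψ (c • ζ)| - |ψ z|)| ≤ ε / 3 := by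
    refine (abs_abs_sub_abs_le _ _).trans ?_
    have h5 := hψ.dist_le_mul (c • ζ) z
    rw [Real.dist_eq, dist_eq_norm] at h5
    have h6 := norm_sub_sq_of_norm_one (z := z) hyn
    rw [hyz, Complex.ofReal_re] at h6
    have h7 : ‖c • ζ - z‖ ≤ ε / (3 * (K + 1)) := by
      refine le_of_sq_le_sq ?_ (by positivity)
      nlinarith [norm_nonneg z]
    rw [le_div_iff₀ (by positivity)] at h7
    have h8 : 0 ≤ ‖c • ζ - z‖ := norm_nonneg _
    nlinarith
  rw [h2] at h1
  rw [abs_le] at *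
  constructor <;> linarith [h1.1, h1.2, h3.1, h3.2, h4.1, h4.2]

/-! ### Polynomials with prescribed degrees -/

/-- The polynomials on `ℂ²` all of whose homogeneous components have degree in `E`. -/
def polynomialsWithDegreesIn (E : Set ℕ) : Submodule ℂ (C2 → ℂ) where
  carrier := {p | IsEFPolynomial E id p}
  zero_mem' := ⟨∅, fun _ => 0, by simp, by simp, by simp⟩
  add_mem' := by
    classical
    rintro p q ⟨s, F, hs, hF, hp⟩ ⟨t, G, ht, hG, hq⟩
    refine ⟨s ∪ t, fun k => (if k ∈ s then F k else 0) + (if k ∈ t then G k else 0), ?_, ?_, ?_⟩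
    · rw [Finset.coe_union]; exact union_subset hs ht
    · intro k _
      have hzero : IsHomogeneousFPolynomial id k 0 :=
        ⟨0, MvPolynomial.isHomogeneous_zero _ _ _, by simp⟩
      have h1 : IsHomogeneousFPolynomial id k (if k ∈ s then F k else 0) := by
        split_ifs with h
        exacts [hF k h, hzero]
      have h2 : IsHomogeneousFPolynomial id k (if k ∈ t then G k else 0) := by
        split_ifs with h
        exacts [hG k h, hzero]
      obtain ⟨a, ha, ha'⟩ := h1
      obtain ⟨b, hb, hb'⟩ := h2
      exact ⟨a + b, ha.add hb, fun z => by
        simp only [Pi.add_apply, ha', hb', map_add]⟩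
    · intro z
      simp only [Pi.add_apply, Finset.sum_add_distrib, hp, hq, ite_apply, Pi.zero_apply,
        Finset.sum_ite_mem, Finset.union_inter_cancel_left, Finset.union_inter_cancel_right]
  smul_mem' := by
    rintro c p ⟨s, F, hs, hF, hp⟩
    refine ⟨s, fun k => c • F k, hs, fun k hk => ?_, fun z => ?_⟩
    · obtain ⟨a, ha, ha'⟩ := hF k hk
      refine ⟨MvPolynomial.C c * a, by simpa using (MvPolynomial.isHomogeneous_C _ c).mul ha,
        fun z => ?_⟩
      simp only [Pi.smul_apply, ha', map_mul, MvPolynomial.eval_C, smul_eq_mul]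
    · simp only [Pi.smul_apply, hp, Finset.smul_sum]

theorem continuous_of_mem_polynomialsWithDegreesIn {E : Set ℕ} {p : C2 → ℂ}
    (hp : p ∈ polynomialsWithDegreesIn E) : Continuous p := by
  obtain ⟨s, F, -, hF, h⟩ := hp
  rw [funext h]
  refine continuous_finsetSum _ fun k hk => ?_
  obtain ⟨a, -, ha⟩ := hF k hk
  rw [funext ha]
  exact (MvPolynomial.continuous_eval a).comp (by simp only [id]; fun_prop)

theorem inner_pow_mem_polynomialsWithDegreesIn {E : Set ℕ} {k : ℕ} (hk : k ∈ E) (ζ : C2) :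
    (fun z => inner ℂ ζ z ^ k) ∈ polynomialsWithDegreesIn E := by
  refine ⟨{k}, fun _ z => inner ℂ ζ z ^ k, by simpa using hk, fun j hj => ?_, by simp⟩
  rw [Finset.mem_singleton] at hj
  subst hj
  refine ⟨(∑ i, MvPolynomial.C ((starRingEnd ℂ) (ζ i)) * MvPolynomial.X i) ^ j, ?_, fun z => ?_⟩
  · have : (∑ i : Fin 2, MvPolynomial.C ((starRingEnd ℂ) (ζ i)) * MvPolynomial.X i :
        MvPolynomial (Fin 2) ℂ).IsHomogeneous 1 :=
      MvPolynomial.IsHomogeneous.sum _ _ _ fun i _ =>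
        MvPolynomial.isHomogeneous_C_mul_X _ _
    simpa using this.pow j
  · simp only [map_pow, map_sum, PiLp.inner_apply]
    simp [mul_comm]

/-! ### Choice of signs -/

section Signs

variable {X : Type*} [MeasurableSpace X] {μ : Measure X}

/-- One of `f + g` and `f - g` is at least as large in `L²` as if `f` and `g` were orthogonal,
by the parallelogram law. -/
theorem exists_sign_integral_le {f g : X → ℂ} (hf : MemLp f 2 μ) (hg : MemLp g 2 μ) :
    ∃ σ : ℂ, ‖σ‖ = 1 ∧
      ∫ x, ‖f x‖ ^ 2 ∂μ + ∫ x, ‖g x‖ ^ 2 ∂μ ≤ ∫ x, ‖f x + σ * g x‖ ^ 2 ∂μ := by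
  have hint : ∀ {h : X → ℂ}, MemLp h 2 μ → Integrable (fun x => ‖h x‖ ^ 2) μ := fun h =>
    (memLp_two_iff_integrable_sq_norm h.1).1 h
  have key : ∫ x, ‖f x + g x‖ ^ 2 ∂μ + ∫ x, ‖f x - g x‖ ^ 2 ∂μ =
      2 * (∫ x, ‖f x‖ ^ 2 ∂μ + ∫ x, ‖g x‖ ^ 2 ∂μ) := by
    have hadd : Integrable (fun x => ‖f x + g x‖ ^ 2) μ := hint (hf.add hg)
    have hsub : Integrable (fun x => ‖f x - g x‖ ^ 2) μ := hint (hf.sub hg)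
    rw [← integral_add hadd hsub, ← integral_add (hint hf) (hint hg), ← integral_const_mul]
    refine integral_congr_ae (Filter.Eventually.of_forall fun x => ?_)
    have := parallelogram_law_with_norm ℝ (f x) (g x)
    simp only
    linarith
  by_cases h : ∫ x, ‖f x‖ ^ 2 ∂μ + ∫ x, ‖g x‖ ^ 2 ∂μ ≤ ∫ x, ‖f x + g x‖ ^ 2 ∂μ
  · exact ⟨1, by simp, by simpa using h⟩
  · refine ⟨-1, by simp, ?_⟩
    simp only [neg_mul, one_mul, ← sub_eq_add_neg]
    linarith

theorem exists_signs_sum_integral_le {ι : Type*} (s : Finset ι) (v : ι → X → ℂ)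
    (hv : ∀ i, MemLp (v i) 2 μ) :
    ∃ σ : ι → ℂ, (∀ i, ‖σ i‖ = 1) ∧
      ∑ i ∈ s, ∫ x, ‖v i x‖ ^ 2 ∂μ ≤ ∫ x, ‖∑ i ∈ s, σ i * v i x‖ ^ 2 ∂μ := by
  classical
  induction s using Finset.induction_on with
  | empty => exact ⟨fun _ => 1, by simp, by simp⟩
  | insert a s ha ih =>
    obtain ⟨σ, hσ, h⟩ := ih
    have hsum : MemLp (fun x => ∑ i ∈ s, σ i * v i x) 2 μ :=
      memLp_finsetSum s fun i _ => (hv i).const_mul (σ i)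
    obtain ⟨τ, hτ, h2⟩ := exists_sign_integral_le hsum (hv a)
    refine ⟨Function.update σ a τ, fun i => ?_, ?_⟩
    · by_cases hi : i = a
      · subst hi; simpa using hτ
      · simpa [hi] using hσ i
    · have : ∀ x, ∑ i ∈ insert a s, Function.update σ a τ i * v i x =
          (∑ i ∈ s, σ i * v i x) + τ * v a x := fun x => by
        rw [Finset.sum_insert ha, Function.update_self, add_comm]
        congr 1
        refine Finset.sum_congr rfl fun i hi => ?_
        rw [Function.update_of_ne (ne_of_mem_of_not_mem hi ha)]
      simp only [this]
      rw [Finset.sum_insert ha]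
      linarith

end Signs

/-! ### Approximation from below, Lipschitz case -/

theorem memLp_two_comp_of_continuous {X : Type*} [MeasurableSpace X] {μ : Measure X}
    [IsFiniteMeasure μ] {w : X → C2} (hw : Measurable w) (hw1 : ∀ x, ‖w x‖ = 1) {F : Type*}
    [NormedAddCommGroup F] [MeasurableSpace F] [BorelSpace F] [SecondCountableTopology F]
    {p : C2 → F} (hp : Continuous p) : MemLp (fun x => p (w x)) 2 μ := by
  obtain ⟨C, hC⟩ := (isCompact_sphere (0 : C2) 1).exists_bound_of_continuousOn hp.continuousOn
  exact MemLp.of_bound (hp.measurable.comp hw).aestronglyMeasurable C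
    (Filter.Eventually.of_forall fun x => hC _ (by simpa using hw1 x))

/-- For a positive Lipschitz function `ψ` there is a polynomial of modulus less than `ψ` on the
closed ball whose mean square is a fixed fraction of that of `ψ`. It is a signed sum of peaks of
high degree `N`, at points whose lines are at mutual distance about `N ^ (-1 / 2)`, each modulated
so as to have modulus about `ψ` along its circle. -/
theorem exists_polynomial_lt_lipschitz : ∃ c : ℝ, 0 < c ∧ ∀ (E : Set ℕ), IsLISet E →
    ∀ {X : Type} [MeasurableSpace X] (μ : Measure X) [IsFiniteMeasure μ] (w : X → C2),
    Measurable w → (∀ x, ‖w x‖ = 1) → ∀ (K : NNReal) (ψ : C2 → ℝ), LipschitzWith K ψ →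
    ∀ κ : ℝ, 0 < κ → (∀ z, ‖z‖ ≤ 1 → κ ≤ ψ z) →
    ∃ p ∈ polynomialsWithDegreesIn E, (∀ z, ‖z‖ ≤ 1 → ‖p z‖ < ψ z) ∧
      c * ∫ x, ψ (w x) ^ 2 ∂μ ≤ ∫ x, ‖p (w x)‖ ^ 2 ∂μ := by
  obtain ⟨C, hC, hpeak⟩ := exists_peak_sum_bound
  refine ⟨(1 / (2 * C)) ^ 2 * (1 / 8), by positivity, ?_⟩
  intro E hE X _ μ _ w hw hw1 K ψ hψ κ hκ hκψ
  obtain ⟨n, m, g, e, H, δ, hδ, hδ1, hH, he, hgH, hmodel⟩ :=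
    exists_polynomial_model hψ (show 0 < κ / 4 by positivity)
  -- The degree is at least `2 T`: this makes the peaks negligible away from their circles, and
  -- makes the model valid at the point of the family nearest to a given point of the sphere.
  obtain ⟨T, hT1, hT2⟩ : ∃ T : ℕ, 1 / δ ≤ T ∧ (1 - δ) ^ T * H ≤ κ / 4 := by
    obtain ⟨T1, h1⟩ := exists_nat_ge (1 / δ)
    obtain ⟨T2, h2⟩ := exists_pow_lt_of_lt_one (show 0 < κ / 4 / (H + 1) by positivity)
      (show 1 - δ < 1 by linarith)
    refine ⟨max T1 T2, h1.trans (by exact_mod_cast le_max_left _ _), ?_⟩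
    have h3 : (1 - δ) ^ max T1 T2 ≤ (1 - δ) ^ T2 :=
      pow_le_pow_of_le_one (by linarith) (by linarith) (le_max_right _ _)
    have h4 := (h3.trans_lt h2).le
    rw [le_div_iff₀ (by positivity)] at h4
    have h5 : 0 ≤ (1 - δ) ^ max T1 T2 := pow_nonneg (by linarith) _
    nlinarith
  obtain ⟨a, ha⟩ := hE (2 * T + 2 + m) (by omega)
  set N : ℕ := 2 * T + 2 + a with hN
  have hNE : ∀ t, N + e t ∈ E := fun t => by
    have := ha (2 * T + 2 + e t) (by omega) (by have := he t; omega)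
    rwa [show 2 * T + 2 + e t + a = N + e t by omega] at this
  have hN0 : (0 : ℝ) < N := by exact_mod_cast (show 0 < N by omega)
  have hNT : 2 * (T : ℝ) ≤ N := by exact_mod_cast (show 2 * T ≤ N by omega)
  obtain ⟨Λ, hΛ, hsep, hcov⟩ := exists_maximal_separated (show (0 : ℝ) < 1 / N by positivity)
  -- Half of the exponent `N` is kept for the bounded sum of peaks; the other half is spent on decay.
  have hpeakN : ∀ z : C2, ‖z‖ ≤ 1 → ∑ b ∈ Λ, ‖inner ℂ b z‖ ^ (N - N / 2) ≤ C := by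
    refine hpeak _ Λ hΛ fun b hb b' hb' hne => ?_
    have h1 := hsep b hb b' hb' hne
    have h2 : (N : ℝ) ≤ 2 * ((N - N / 2 : ℕ) : ℝ) := by
      exact_mod_cast (show N ≤ 2 * (N - N / 2) by omega)
    rw [div_le_iff₀ hN0] at h1
    nlinarith
  let v : C2 → C2 → ℂ := fun b z => ∑ t, g t b * inner ℂ b z ^ (N + e t)
  have hvE : ∀ b, v b ∈ polynomialsWithDegreesIn E := fun b => by
    have : v b = ∑ t, g t b • fun z => inner ℂ b z ^ (N + e t) := by
      ext z; simp [v]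
    rw [this]
    exact Submodule.sum_mem _ fun t _ =>
      Submodule.smul_mem _ _ (inner_pow_mem_polynomialsWithDegreesIn (hNE t) b)
  have hvnorm : ∀ b z, ‖v b z‖ = ‖inner ℂ b z‖ ^ N * ‖∑ t, g t b * inner ℂ b z ^ e t‖ := by
    intro b z
    rw [← norm_pow, ← norm_mul, Finset.mul_sum]
    simp only [v, pow_add]
    congr 1
    exact Finset.sum_congr rfl fun t _ => by ring
  have hu1 : ∀ b ∈ Λ, ∀ z : C2, ‖z‖ ≤ 1 → ‖inner ℂ b z‖ ≤ 1 := fun b hb z hz => by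
    have := norm_inner_le_norm (𝕜 := ℂ) b z
    rw [hΛ b hb, one_mul] at this
    exact this.trans hz
  -- The peak at `b` is at most `5 / 4 * ψ` times a summable weight, near its circle by the model and
  -- elsewhere by decay.
  have hvub : ∀ b ∈ Λ, ∀ z : C2, ‖z‖ ≤ 1 →
      ‖v b z‖ ≤ ‖inner ℂ b z‖ ^ (N - N / 2) * (5 / 4 * ψ z) := by
    intro b hb z hz
    have hψz := hκψ z hz
    have hle1 := hu1 b hb z hz
    have hsplit : ‖inner ℂ b z‖ ^ N = ‖inner ℂ b z‖ ^ (N - N / 2) * ‖inner ℂ b z‖ ^ (N / 2) := by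
      rw [← pow_add]; congr 1; omega
    rw [hvnorm, hsplit, mul_assoc]
    refine mul_le_mul_of_nonneg_left ?_ (by positivity)
    rcases le_or_gt (1 - δ) ‖inner ℂ b z‖ with hnear | hfar
    · have h1 := (abs_le.1 (hmodel b z (hΛ b hb) hz hnear)).2
      rw [abs_of_pos (by linarith)] at h1
      calc _ ≤ 1 * ‖∑ t, g t b * inner ℂ b z ^ e t‖ := by
            gcongr; exact pow_le_one₀ (norm_nonneg _) hle1
        _ ≤ _ := by linarith
    · have h1 : ‖∑ t, g t b * inner ℂ b z ^ e t‖ ≤ H := by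
        refine le_trans (norm_sum_le_of_le _ fun t _ => ?_) (hgH b (hΛ b hb))
        rw [norm_mul, norm_pow]
        exact mul_le_of_le_one_right (norm_nonneg _) (pow_le_one₀ (norm_nonneg _) hle1)
      have h2 : ‖inner ℂ b z‖ ^ (N / 2) ≤ (1 - δ) ^ T :=
        (pow_le_pow_of_le_one (norm_nonneg _) hle1 (show T ≤ N / 2 by omega)).trans
          (pow_le_pow_left₀ (norm_nonneg _) hfar.le _)
      calc _ ≤ (1 - δ) ^ T * H := by
            gcongr
        _ ≤ _ := by linarith
  -- At each point of the sphere the nearest peak alone has modulus at least `3 / 8 * ψ`.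
  have hvlb : ∀ z : C2, ‖z‖ = 1 → 1 / 8 * ψ z ^ 2 ≤ ∑ b ∈ Λ, ‖v b z‖ ^ 2 := by
    intro z hz
    have hψz := hκψ z hz.le
    obtain ⟨b, hb, hbz⟩ := hcov z hz
    refine le_trans ?_ (Finset.single_le_sum (f := fun b => ‖v b z‖ ^ 2)
      (fun _ _ => sq_nonneg _) hb)
    have h1 : 1 - 1 / (2 * N : ℝ) ≤ ‖inner ℂ b z‖ := by
      have : 1 / (2 * N : ℝ) = (1 / N) / 2 := by field_simp
      rw [this]; linarith
    have h2 : 1 - δ ≤ ‖inner ℂ b z‖ := by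
      refine le_trans ?_ h1
      have : 1 / (2 * N : ℝ) ≤ δ := by
        rw [div_le_iff₀ hδ] at hT1
        rw [div_le_iff₀ (by positivity)]
        nlinarith
      linarith
    have h3 : 1 / 2 ≤ ‖inner ℂ b z‖ ^ N := by
      have hN1 : (1 : ℝ) ≤ N := by exact_mod_cast (show 1 ≤ N by omega)
      have h4 : 1 / (2 * N : ℝ) ≤ 1 := by
        rw [div_le_iff₀ (by positivity)]; linarith
      have h5 := one_add_mul_le_pow (a := -(1 / (2 * N : ℝ))) (by linarith) N
      have h6 : 1 + (N : ℝ) * -(1 / (2 * N : ℝ)) = 1 / 2 := by field_simp; norm_num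
      rw [h6] at h5
      exact h5.trans (pow_le_pow_left₀ (by linarith) (by linarith) N)
    have h4 := (abs_le.1 (hmodel b z (hΛ b hb) hz.le h2)).1
    rw [abs_of_pos (by linarith)] at h4
    have h5 : 3 / 8 * ψ z ≤ ‖v b z‖ := by
      rw [hvnorm]
      calc 3 / 8 * ψ z = 1 / 2 * (3 / 4 * ψ z) := by ring
        _ ≤ _ := mul_le_mul h3 (by linarith) (by linarith) (by positivity)
    calc 1 / 8 * ψ z ^ 2 ≤ (3 / 8 * ψ z) ^ 2 := by nlinarith [sq_nonneg (ψ z)]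
      _ ≤ _ := pow_le_pow_left₀ (by linarith) h5 2
  have hvL2 : ∀ b, MemLp (fun x => v b (w x)) 2 μ := fun b =>
    memLp_two_comp_of_continuous hw hw1 (continuous_of_mem_polynomialsWithDegreesIn (hvE b))
  obtain ⟨σ, hσ, hsum⟩ := exists_signs_sum_integral_le Λ (fun b x => v b (w x)) hvL2
  refine ⟨((1 / (2 * C) : ℝ) : ℂ) • ∑ b ∈ Λ, σ b • v b, Submodule.smul_mem _ _ <|
    Submodule.sum_mem _ fun b _ => Submodule.smul_mem _ _ (hvE b), fun z hz => ?_, ?_⟩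
  · have hψz := hκψ z hz
    have h1 : ‖∑ b ∈ Λ, σ b * v b z‖ ≤ C * (5 / 4 * ψ z) :=
      calc _ ≤ ∑ b ∈ Λ, ‖inner ℂ b z‖ ^ (N - N / 2) * (5 / 4 * ψ z) :=
            norm_sum_le_of_le _ fun b hb => by
              rw [norm_mul, hσ, one_mul]; exact hvub b hb z hz
        _ = (∑ b ∈ Λ, ‖inner ℂ b z‖ ^ (N - N / 2)) * (5 / 4 * ψ z) := by rw [Finset.sum_mul]
        _ ≤ _ := mul_le_mul_of_nonneg_right (hpeakN z hz) (by linarith)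
    simp only [Pi.smul_apply, Finset.sum_apply, smul_eq_mul, norm_mul, Complex.norm_real]
    rw [Real.norm_eq_abs, abs_of_pos (by positivity), div_mul_eq_mul_div, div_lt_iff₀ (by positivity)]
    nlinarith
  · simp only [Pi.smul_apply, Finset.sum_apply, smul_eq_mul, norm_mul, Complex.norm_real, mul_pow]
    rw [integral_const_mul, Real.norm_eq_abs, sq_abs, mul_assoc]
    refine mul_le_mul_of_nonneg_left (le_trans ?_ hsum) (by positivity)
    have hint : ∀ b, Integrable (fun x => ‖v b (w x)‖ ^ 2) μ := fun b =>
      (memLp_two_iff_integrable_sq_norm (hvL2 b).1).1 (hvL2 b)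
    rw [← integral_const_mul, ← integral_finsetSum _ fun b _ => hint b]
    refine integral_mono_of_nonneg (Filter.Eventually.of_forall fun x => by positivity)
      (integrable_finsetSum _ fun b _ => hint b)
      (Filter.Eventually.of_forall fun x => hvlb _ (hw1 x))

/-! ### Lipschitz regularization of lower semicontinuous functions -/

/-- The infimal convolution `x ↦ inf (φ y + n |x - y|)` of `φ`, with the infimum over the closed
unit ball. It is the largest function of Lipschitz constant `n` that is at most `φ` there. -/
noncomputable def lipschitzRegularization (φ : C2 → ℝ) (n : ℕ) (x : C2) : ℝ :=
  ⨅ y : closedBall (0 : C2) 1, (φ y + n * dist x (y : C2))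

section Regularization

variable {φ : C2 → ℝ} {κ : ℝ}

instance nonempty_closedBall_C2 : Nonempty (closedBall (0 : C2) 1) := ⟨⟨0, by simp⟩⟩

theorem bddBelow_range_add_dist (hκ : ∀ z ∈ closedBall (0 : C2) 1, κ ≤ φ z) (n : ℕ) (x : C2) :
    BddBelow (range fun y : closedBall (0 : C2) 1 => φ y + n * dist x (y : C2)) := by
  refine ⟨κ, ?_⟩
  rintro _ ⟨y, rfl⟩
  have : 0 ≤ n * dist x (y : C2) := by positivity
  linarith [hκ y y.2]

theorem lipschitzRegularization_lipschitzWith (hκ : ∀ z ∈ closedBall (0 : C2) 1, κ ≤ φ z) (n : ℕ) :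
    LipschitzWith n (lipschitzRegularization φ n) := by
  refine LipschitzWith.of_le_add_mul _ fun x x' => ?_
  rw [← sub_le_iff_le_add]
  refine le_ciInf fun y => ?_
  rw [sub_le_iff_le_add]
  refine (ciInf_le (bddBelow_range_add_dist hκ n x) y).trans ?_
  have := dist_triangle x x' y
  have hn : (0 : ℝ) ≤ n := Nat.cast_nonneg n
  rw [NNReal.coe_natCast]
  nlinarith

theorem le_lipschitzRegularization (hκ : ∀ z ∈ closedBall (0 : C2) 1, κ ≤ φ z) (n : ℕ) (x : C2) :
    κ ≤ lipschitzRegularization φ n x := by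
  refine le_ciInf fun y => ?_
  have : 0 ≤ n * dist x (y : C2) := by positivity
  linarith [hκ y y.2]

theorem lipschitzRegularization_le (hκ : ∀ z ∈ closedBall (0 : C2) 1, κ ≤ φ z) (n : ℕ) {x : C2}
    (hx : x ∈ closedBall (0 : C2) 1) : lipschitzRegularization φ n x ≤ φ x := by
  refine (ciInf_le (bddBelow_range_add_dist hκ n x) ⟨x, hx⟩).trans ?_
  simp

theorem tendsto_lipschitzRegularization (hκ0 : 0 ≤ κ)
    (hκ : ∀ z ∈ closedBall (0 : C2) 1, κ ≤ φ z)
    (hφ : LowerSemicontinuousOn φ (closedBall 0 1)) {x : C2} (hx : x ∈ closedBall (0 : C2) 1) :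
    Filter.Tendsto (fun n => lipschitzRegularization φ n x) Filter.atTop (nhds (φ x)) := by
  rw [Metric.tendsto_atTop]
  intro ε hε
  have h1 := hφ x hx (φ x - ε / 2) (by linarith)
  obtain ⟨δ, hδ, h2⟩ := Metric.mem_nhdsWithin_iff.1 h1
  obtain ⟨n0, hn0⟩ := exists_nat_ge (φ x / δ)
  refine ⟨n0, fun n hn => ?_⟩
  rw [div_le_iff₀ hδ] at hn0
  have hnn : (n0 : ℝ) ≤ n := by exact_mod_cast hn
  have h3 := lipschitzRegularization_le hκ n hx
  have h4 : φ x - ε / 2 ≤ lipschitzRegularization φ n x := by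
    refine le_ciInf fun y => ?_
    have hy : 0 ≤ n * dist x (y : C2) := by positivity
    rcases lt_or_ge (dist (y : C2) x) δ with hd | hd
    · have : φ x - ε / 2 < φ y := h2 ⟨hd, y.2⟩
      linarith
    · rw [dist_comm] at hd
      have := hκ y y.2
      nlinarith
  rw [Real.dist_eq, abs_lt]
  constructor <;> linarith

end Regularization

theorem exists_pos_le_of_lowerSemicontinuousOn {φ : C2 → ℝ}
    (hpos : ∀ z ∈ closedBall (0 : C2) 1, 0 < φ z)
    (hφ : LowerSemicontinuousOn φ (closedBall 0 1)) :
    ∃ κ, 0 < κ ∧ ∀ z ∈ closedBall (0 : C2) 1, κ ≤ φ z := by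
  obtain ⟨a, ha, h⟩ := hφ.exists_isMinOn ⟨0, by simp⟩ (isCompact_closedBall (0 : C2) 1)
  exact ⟨φ a, hpos a ha, fun z hz => h hz⟩

theorem exists_lipschitz_minorant {X : Type*} [MeasurableSpace X] {μ : Measure X} {w : X → C2}
    (hw : Measurable w) (hw1 : ∀ x, ‖w x‖ = 1) {φ : C2 → ℝ}
    (hpos : ∀ z ∈ closedBall (0 : C2) 1, 0 < φ z)
    (hφ : LowerSemicontinuousOn φ (closedBall 0 1)) (hL2 : MemLp (fun x => φ (w x)) 2 μ) :
    ∃ (K : NNReal) (ψ : C2 → ℝ) (κ : ℝ), LipschitzWith K ψ ∧ 0 < κ ∧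
      (∀ z ∈ closedBall (0 : C2) 1, κ ≤ ψ z ∧ ψ z ≤ φ z) ∧
      1 / 2 * ∫ x, φ (w x) ^ 2 ∂μ ≤ ∫ x, ψ (w x) ^ 2 ∂μ := by
  obtain ⟨κ, hκ0, hκ⟩ := exists_pos_le_of_lowerSemicontinuousOn hpos hφ
  have hwB : ∀ x, w x ∈ closedBall (0 : C2) 1 := fun x => by simp [hw1 x]
  have hlim : Filter.Tendsto (fun n : ℕ => ∫ x, lipschitzRegularization φ n (w x) ^ 2 ∂μ)
      Filter.atTop (nhds (∫ x, φ (w x) ^ 2 ∂μ)) := by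
    refine tendsto_integral_of_dominated_convergence (fun x => φ (w x) ^ 2) (fun n => ?_)
      hL2.integrable_sq (fun n => Filter.Eventually.of_forall fun x => ?_)
      (Filter.Eventually.of_forall fun x =>
        (tendsto_lipschitzRegularization hκ0.le hκ hφ (hwB x)).pow 2)
    · exact (((lipschitzRegularization_lipschitzWith hκ n).continuous.measurable.comp
        hw).pow_const 2).aestronglyMeasurable
    · rw [Real.norm_eq_abs, abs_of_nonneg (sq_nonneg _)]
      exact pow_le_pow_left₀ (hκ0.le.trans (le_lipschitzRegularization hκ n _))
        (lipschitzRegularization_le hκ n (hwB x)) 2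
  have hI : 0 ≤ ∫ x, φ (w x) ^ 2 ∂μ := integral_nonneg fun x => sq_nonneg _
  obtain ⟨n, hn⟩ : ∃ n : ℕ, 1 / 2 * ∫ x, φ (w x) ^ 2 ∂μ ≤
      ∫ x, lipschitzRegularization φ n (w x) ^ 2 ∂μ := by
    rcases hI.eq_or_lt with h0 | h0
    · exact ⟨0, by rw [← h0, mul_zero]; exact integral_nonneg fun x => sq_nonneg _⟩
    · obtain ⟨n, hn⟩ := (hlim.eventually_const_lt
        (show 1 / 2 * ∫ x, φ (w x) ^ 2 ∂μ < ∫ x, φ (w x) ^ 2 ∂μ by linarith)).exists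
      exact ⟨n, hn.le⟩
  exact ⟨n, _, κ, lipschitzRegularization_lipschitzWith hκ n, hκ0, fun z hz =>
    ⟨le_lipschitzRegularization hκ n z, lipschitzRegularization_le hκ n hz⟩, hn⟩

theorem isFiniteMeasure_of_memLp_of_le {X : Type*} [MeasurableSpace X] {μ : Measure X}
    {h : X → ℝ} (hL2 : MemLp h 2 μ) {κ : ℝ} (hκ : 0 < κ) (hle : ∀ x, κ ≤ h x) :
    IsFiniteMeasure μ := by
  have h1 : MemLp (fun _ : X => κ) 2 μ := by
    refine hL2.mono aestronglyMeasurable_const (Filter.Eventually.of_forall fun x => ?_)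
    rw [Real.norm_eq_abs, Real.norm_eq_abs, abs_of_pos hκ]
    exact (hle x).trans (le_abs_self _)
  rw [memLp_const_iff (by norm_num) (by norm_num)] at h1
  exact ⟨h1.resolve_left hκ.ne'⟩

/-! ### Approximation from below, lower semicontinuous case -/

/-- The weak form of the approximation theorem: some fraction `c` of the mean square of `φ`, with
`c` independent of `φ`, is attained by a polynomial of modulus less than `φ`. -/
theorem exists_polynomial_lt_of_lowerSemicontinuousOn : ∃ c : ℝ, 0 < c ∧ ∀ (E : Set ℕ),
    IsLISet E → ∀ {X : Type} [MeasurableSpace X] (μ : Measure X) (w : X → C2),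
    Measurable w → (∀ x, ‖w x‖ = 1) → ∀ φ : C2 → ℝ, (∀ z ∈ closedBall (0 : C2) 1, 0 < φ z) →
    LowerSemicontinuousOn φ (closedBall 0 1) → MemLp (fun x => φ (w x)) 2 μ →
    ∃ p ∈ polynomialsWithDegreesIn E, (∀ z ∈ closedBall (0 : C2) 1, ‖p z‖ < φ z) ∧
      c * ∫ x, φ (w x) ^ 2 ∂μ ≤ ∫ x, ‖p (w x)‖ ^ 2 ∂μ := by
  obtain ⟨c, hc, h⟩ := exists_polynomial_lt_lipschitz
  refine ⟨c / 2, by positivity, ?_⟩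
  intro E hE X _ μ w hw hw1 φ hpos hφ hL2
  obtain ⟨K, ψ, κ, hψ, hκ, hψφ, hint⟩ := exists_lipschitz_minorant hw hw1 hpos hφ hL2
  have hfin : IsFiniteMeasure μ := isFiniteMeasure_of_memLp_of_le hL2 hκ fun x =>
    have hx := hψφ (w x) (by simp [hw1 x])
    hx.1.trans hx.2
  obtain ⟨p, hp, hlt, hle⟩ := h E hE μ w hw hw1 K ψ hψ κ hκ fun z hz =>
    (hψφ z (by simpa using hz)).1
  refine ⟨p, hp, fun z hz => (hlt z (by simpa using hz)).trans_le (hψφ z hz).2, le_trans ?_ hle⟩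
  calc c / 2 * ∫ x, φ (w x) ^ 2 ∂μ = c * (1 / 2 * ∫ x, φ (w x) ^ 2 ∂μ) := by ring
    _ ≤ _ := by gcongr

/-- The constant in the weak form can be raised to any value below `1 / 2`: as long as it is not
reached by `p`, the gap `φ - |p|` has a mean square bounded below, and adding a polynomial that
fits into the gap, with the right sign, raises the mean square by a fixed amount. -/
theorem exists_polynomial_lt_of_mean_square {E : Set ℕ} (hE : IsLISet E) {X : Type}
    [MeasurableSpace X] {μ : Measure X} (hμ : μ ≠ 0) {w : X → C2} (hw : Measurable w)
    (hw1 : ∀ x, ‖w x‖ = 1) {φ : C2 → ℝ} (hpos : ∀ z ∈ closedBall (0 : C2) 1, 0 < φ z)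
    (hφ : LowerSemicontinuousOn φ (closedBall 0 1)) (hL2 : MemLp (fun x => φ (w x)) 2 μ)
    {θ : ℝ} (hθ : θ < 1 / 2) :
    ∃ p ∈ polynomialsWithDegreesIn E, (∀ z ∈ closedBall (0 : C2) 1, ‖p z‖ < φ z) ∧
      θ * ∫ x, φ (w x) ^ 2 ∂μ < ∫ x, ‖p (w x)‖ ^ 2 ∂μ := by
  obtain ⟨c, hc, hweak⟩ := exists_polynomial_lt_of_lowerSemicontinuousOn
  have hwB : ∀ x, w x ∈ closedBall (0 : C2) 1 := fun x => by simp [hw1 x]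
  obtain ⟨κ, hκ0, hκ⟩ := exists_pos_le_of_lowerSemicontinuousOn hpos hφ
  have hfin : IsFiniteMeasure μ := isFiniteMeasure_of_memLp_of_le hL2 hκ0 fun x => hκ _ (hwB x)
  set I := ∫ x, φ (w x) ^ 2 ∂μ with hI
  have hIpos : 0 < I := by
    refine (integral_pos_iff_support_of_nonneg (fun x => sq_nonneg _) hL2.integrable_sq).2 ?_
    have : Function.support (fun x => φ (w x) ^ 2) = univ :=
      eq_univ_of_forall fun x => (pow_pos (hpos _ (hwB x)) 2).ne'
    rw [this]
    exact Measure.measure_univ_pos.2 hμ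
  by_contra! hcon
  have hstep : ∀ n : ℕ, ∃ p ∈ polynomialsWithDegreesIn E,
      (∀ z ∈ closedBall (0 : C2) 1, ‖p z‖ < φ z) ∧
      n * (c * ((1 / 2 - θ) * I)) ≤ ∫ x, ‖p (w x)‖ ^ 2 ∂μ := by
    intro n
    induction n with
    | zero => exact ⟨0, Submodule.zero_mem _, by simpa using hpos, by simp⟩
    | succ n ih =>
      obtain ⟨p, hp, hlt, hle⟩ := ih
      have hpc := continuous_of_mem_polynomialsWithDegreesIn hp
      have hpL2 : MemLp (fun x => p (w x)) 2 μ := memLp_two_comp_of_continuous hw hw1 hpc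
      have hgapL2 : MemLp (fun x => φ (w x) - ‖p (w x)‖) 2 μ := hL2.sub hpL2.norm
      obtain ⟨q, hq, hqlt, hqle⟩ := hweak E hE μ w hw hw1 (fun z => φ z - ‖p z‖)
        (fun z hz => sub_pos.2 (hlt z hz)) (by
          simp only [sub_eq_add_neg]
          exact hφ.add ((continuous_neg.comp hpc.norm).lowerSemicontinuous.lowerSemicontinuousOn _)) hgapL2
      have hqL2 : MemLp (fun x => q (w x)) 2 μ := memLp_two_comp_of_continuous hw hw1
        (continuous_of_mem_polynomialsWithDegreesIn hq)
      have hpint : Integrable (fun x => ‖p (w x)‖ ^ 2) μ :=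
        (memLp_two_iff_integrable_sq_norm hpL2.1).1 hpL2
      have hgap : (1 / 2 - θ) * I ≤ ∫ x, (φ (w x) - ‖p (w x)‖) ^ 2 ∂μ := by
        -- `φ ^ 2 ≤ 2 |p| ^ 2 + 2 (φ - |p|) ^ 2` pointwise
        have h1 : I ≤ 2 * ∫ x, ‖p (w x)‖ ^ 2 ∂μ + 2 * ∫ x, (φ (w x) - ‖p (w x)‖) ^ 2 ∂μ := by
          rw [← integral_const_mul, ← integral_const_mul,
            ← integral_add (hpint.const_mul 2) (hgapL2.integrable_sq.const_mul 2)]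
          refine integral_mono hL2.integrable_sq
            ((hpint.const_mul 2).add (hgapL2.integrable_sq.const_mul 2)) fun x => ?_
          nlinarith [sq_nonneg (φ (w x) - 2 * ‖p (w x)‖)]
        have h2 := hcon p hp hlt
        linarith
      obtain ⟨σ, hσ, hsum⟩ := exists_sign_integral_le hpL2 hqL2
      refine ⟨p + σ • q, Submodule.add_mem _ hp (Submodule.smul_mem _ _ hq), fun z hz => ?_, ?_⟩
      · refine (norm_add_le _ _).trans_lt ?_
        rw [Pi.smul_apply, norm_smul, hσ, one_mul]
        linarith [hqlt z hz]
      · simp only [Pi.add_apply, Pi.smul_apply, smul_eq_mul]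
        have h3 := mul_le_mul_of_nonneg_left hgap hc.le
        push_cast
        linarith
  have hd : 0 < c * ((1 / 2 - θ) * I) := mul_pos hc (mul_pos (by linarith) hIpos)
  obtain ⟨n, hn⟩ := exists_nat_gt (θ * I / (c * ((1 / 2 - θ) * I)))
  rw [div_lt_iff₀ hd] at hn
  obtain ⟨p, hp, hlt, hle⟩ := hstep n
  linarith [hcon p hp hlt]

/-! ### Transfer to the covering -/

theorem mainTheorem3 (M : Set C2) (f : C2 → C2) (N : ℕ) (hf : IsBallCovering M f N)
    (E : Set ℕ) (hE : IsLISet E)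
    (μ : Measure (frontier M)) (hμ : μ ≠ 0)
    (φ : C2 → ℝ) (hφ_pos : ∀ w ∈ closedBall (0 : C2) 1, 0 < φ w)
    (hφ_lsc : LowerSemicontinuousOn φ (closedBall 0 1))
    (hφ_L2 : MemLp (fun z : frontier M => φ (f z)) 2 μ) :
    ∃ P : C2 → ℂ, IsEFPolynomial E f P ∧
      (∀ z ∈ closure M, ‖P z‖ < φ (f z)) ∧
      (8 / 25 : ℝ) * ∫ z : frontier M, φ (f z) ^ 2 ∂μ < ∫ z : frontier M, ‖P z‖ ^ 2 ∂μ := by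
  have hfc : Continuous f := hf.holomorphic.continuous
  have hbd : ∀ z ∈ frontier M, f z ∈ sphere (0 : C2) 1 := fun z hz =>
    hf.image_boundary ▸ mem_image_of_mem f hz
  have hcl : ∀ z ∈ closure M, f z ∈ closedBall (0 : C2) 1 := fun z hz => by
    have h1 : f z ∈ closure (f '' M) := image_closure_subset_closure_image hfc ⟨z, hz, rfl⟩
    rw [hf.image_interior] at h1
    exact closure_ball_subset_closedBall h1
  obtain ⟨p, ⟨s, F, hs, hF, hp⟩, hlt, hint⟩ := exists_polynomial_lt_of_mean_square hE hμ
    (w := fun z : frontier M => f z) (hfc.measurable.comp measurable_subtype_coe)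
    (fun z => by simpa using hbd z z.2) hφ_pos hφ_lsc hφ_L2 (show (8 / 25 : ℝ) < 1 / 2 by norm_num)
  refine ⟨fun z => p (f z), ⟨s, fun k z => F k (f z), hs, fun k hk => ?_, fun z => hp (f z)⟩,
    fun z hz => hlt (f z) (hcl z hz), hint⟩
  obtain ⟨a, ha, ha'⟩ := hF k hk
  exact ⟨a, ha, fun z => ha' (f z)⟩
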